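/- Let $\mathcal H$ be a complex Hilbert space with inner product $\langle\cdot,\cdot\rangle$ antilinear in the first argument, and let $A\in\mathscr S(\mathcal H)$, i.e. $A$ is a closed symmetric linear operator in $\mathcal H$, with domain not necessarily dense, with deficiency indices $(1,1)$, which is regular: for every $z\in\mathbb C$ there is $d_z>0$ with $\|(A-zI)\varphi\|\ge d_z\|\varphi\|$ for all $\varphi\in\operatorname{dom}A$. Let $A^*=\{(\eta,\omega)\in\mathcal H\oplus\mathcal H:\langle\eta,A\varphi\rangle=\langle\omega,\varphi\rangle\ \forall\varphi\in\operatorname{dom}A\}$ be its adjoint (a linear relation), and $\ker(A^*-zI)=\{\eta:(\eta,z\eta)\in A^*\}$. A canonical selfadjoint extension of $A$ is a linear relation $B\subseteq\mathcal H\oplus\mathcal H$ which contains the graph of $A$ and satisfies $B^*=B$; its spectrum $\operatorname{Sp}(B)$ is the complement of the set of $z\in\mathbb C$ for which $(B-zI)^{-1}$ is a bounded operator defined on all of $\mathcal H$. For $n\in\{0,1,2,\dots\}$, $A$ is called $n$-entire if there are $\mu_0,\dots,\mu_n\in\mathcal H$ such that $$\mathcal H=\operatorname{ran}(A-zI)\dotplus\operatorname{span}\{\mu_0+z\mu_1+\cdots+z^n\mu_n\}\qquad\text{for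 all }z\in\mathbb C .$$ Functional model. Let $J$ be an involution on $\mathcal H$ (antiunitary, $J^2=I$) that commutes with every canonical selfadjoint extension $B$ of $A$, i.e. $J(B-zI)^{-1}=(B-\bar zI)^{-1}J$ for $z\in\mathbb C\setminus\mathbb R$. Let $A_\gamma$ be a canonical selfadjoint extension of $A$, $v\in\mathbb R\setminus\operatorname{Sp}(A_\gamma)$, $0\ne\psi_v\in\ker(A^*-vI)$ with $J\psi_v=\psi_v$, and $h_\gamma$ an entire function with $h_\gamma(\bar z)=\overline{h_\gamma(z)}$ whose zeros are all simple and form the set $\operatorname{Sp}(A_\gamma)$. Put $$\xi(z)=h_\gamma(z)\,\bigl[I+(z-v)(A_\gamma-zI)^{-1}\bigr]\psi_v ,$$ where the (removable) singularities at the points of $\operatorname{Sp}(A_\gamma)$ are removed by taking limits. Let $(\Phi\varphi)(z)=\langle\xi(\bar z),\varphi\rangle$ for $\varphi\in\mathcal H$, and let $\widehat{\mathcal H}=\Phi\mathcal H$ be the resulting (de Branges) space of entire functions, with the inner product transported from $\mathcal H$ by $\Phi$. Put $$\operatorname{assoc}_n\widehat{\mathcal H}=\widehat{\mathcal H}+z\widehat{\mathcal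 H}+\cdots+z^n\widehat{\mathcal H}.$$ Then, for every $n\in\{0,1,2,\dots\}$ and for every choice of $J$, $A_\gamma$, $v$, $\psi_v$, $h_\gamma$ as above, $A$ is $n$-entire if and only if $\operatorname{assoc}_n\widehat{\mathcal H}$ contains a zero-free entire function. -/

import Mathlib

open Topology ComplexConjugate

noncomputable section

namespace NEntire

variable {H : Type*} [NormedAddCommGroup H] [InnerProductSpace ℂ H]

/-- `ran(A - zI)` for an operator `A` with domain `A.domain`. -/
def ranShift (A : H →ₗ.[ℂ] H) (z : ℂ) : Submodule ℂ H :=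
  LinearMap.range (A.toFun - z • A.domain.subtype)

/-- `ker(B - zI) = {η : (η, zη) ∈ B}` for a linear relation `B ⊆ H ⊕ H`. -/
def kerShift (B : Submodule ℂ (H × H)) (z : ℂ) : Submodule ℂ H :=
  B.comap (LinearMap.prod LinearMap.id (z • LinearMap.id))

/-- The adjoint linear relation
`A* = {(η, ω) : ⟪η, Aφ⟫ = ⟪ω, φ⟫ for all φ ∈ dom A}`; the domain of `A` need not be dense. -/
def adjointRel (A : H →ₗ.[ℂ] H) : Submodule ℂ (H × H) :=
  A.graph.adjoint

/-- The class `S(H)`: regular, closed, symmetric operators, not necessarily densely defined,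
with deficiency indices `(1, 1)`. -/
structure InClassS (A : H →ₗ.[ℂ] H) : Prop where
  closed : A.IsClosed
  symmetric : ∀ φ ψ : A.domain, inner ℂ (A φ) (ψ : H) = inner ℂ (φ : H) (A ψ)
  deficiency_upper : Module.finrank ℂ (kerShift (adjointRel A) Complex.I) = 1
  deficiency_lower : Module.finrank ℂ (kerShift (adjointRel A) (-Complex.I)) = 1
  regular : ∀ z : ℂ, ∃ d : ℝ, 0 < d ∧ ∀ φ : A.domain, d * ‖(φ : H)‖ ≤ ‖A φ - z • (φ : H)‖

/-- `A` is `n`-entire: `A ∈ S(H)` and there are `μ₀, …, μₙ ∈ H` such that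
`H = ran(A - zI) ∔ span{μ₀ + z μ₁ + ⋯ + zⁿ μₙ}` for all `z ∈ ℂ`. -/
def IsNEntire (n : ℕ) (A : H →ₗ.[ℂ] H) : Prop :=
  InClassS A ∧ ∃ μ : Fin (n + 1) → H, ∀ z : ℂ,
    IsCompl (ranShift A z) (Submodule.span ℂ {∑ k : Fin (n + 1), z ^ (k : ℕ) • μ k})

/-- `B` is a canonical selfadjoint extension of `A`: a linear relation in `H` that contains
the graph of `A` and equals its adjoint. -/
def IsCanonicalSelfAdjointExtension (A : H →ₗ.[ℂ] H) (B : Submodule ℂ (H × H)) : Prop :=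
  A.graph ≤ B ∧ B.adjoint = B

/-- The relation `(B - zI)⁻¹ = {(φ, η) : (η, φ + zη) ∈ B}` is (the graph of) the bounded
everywhere defined operator `R`. -/
def IsResolvent (B : Submodule ℂ (H × H)) (z : ℂ) (R : H →L[ℂ] H) : Prop :=
  ∀ φ η : H, (η, φ + z • η) ∈ B ↔ η = R φ

/-- The spectrum of a linear relation. -/
def relSpectrum (B : Submodule ℂ (H × H)) : Set ℂ :=
  {z | ¬ ∃ R : H →L[ℂ] H, IsResolvent B z R}

open Classical in
/-- The resolvent `(B - zI)⁻¹` (set to `0` on the spectrum, where it is never used). -/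
def relResolvent (B : Submodule ℂ (H × H)) (z : ℂ) : H →L[ℂ] H :=
  if h : ∃ R : H →L[ℂ] H, IsResolvent B z R then h.choose else 0

/-- The antiunitary map `J` commutes with the selfadjoint relation `B`. -/
def CommutesWith (J : H ≃ₗᵢ⋆[ℂ] H) (B : Submodule ℂ (H × H)) : Prop :=
  ∀ z : ℂ, z.im ≠ 0 → ∀ φ : H, J (relResolvent B z φ) = relResolvent B (conj z) (J φ)

/-- The choices that enter the functional model of `A`:
* an involution `J` (antiunitary, with `J² = I`) that commutes with every canonical selfadjoint
  extension of `A`;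
* a canonical selfadjoint extension `Aγ` of `A`;
* a real point `v` outside the spectrum of `Aγ` and a nonzero `ψ ∈ ker(A* - vI)` with `Jψ = ψ`;
* a real entire function `h` whose zeros are simple and form the spectrum of `Aγ`. -/
structure ModelData (A : H →ₗ.[ℂ] H) where
  J : H ≃ₗᵢ⋆[ℂ] H
  J_involutive : ∀ φ : H, J (J φ) = φ
  J_commutes : ∀ B, IsCanonicalSelfAdjointExtension A B → CommutesWith J B
  Aγ : Submodule ℂ (H × H)
  isExtension : IsCanonicalSelfAdjointExtension A Aγ
  v : ℝ
  v_notMem : (v : ℂ) ∉ relSpectrum Aγ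
  ψ : H
  ψ_mem : ψ ∈ kerShift (adjointRel A) (v : ℂ)
  ψ_ne_zero : ψ ≠ 0
  J_ψ : J ψ = ψ
  h : ℂ → ℂ
  h_entire : Differentiable ℂ h
  h_real : ∀ z : ℂ, h (conj z) = conj (h z)
  h_zero_iff : ∀ z : ℂ, h z = 0 ↔ z ∈ relSpectrum Aγ
  h_simple : ∀ z : ℂ, h z = 0 → deriv h z ≠ 0

namespace ModelData

variable {A : H →ₗ.[ℂ] H} (M : ModelData A)

/-- The expression `h(z) [I + (z - v)(Aγ - zI)⁻¹] ψ`, for `z` outside the spectrum of `Aγ`. -/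
def xiAux (z : ℂ) : H :=
  M.h z • (M.ψ + (z - (M.v : ℂ)) • relResolvent M.Aγ z M.ψ)

open Classical in
/-- The vector-valued function `ξ(z) = h(z) [I + (z - v)(Aγ - zI)⁻¹] ψ`, whose singularities at
the points of the spectrum of `Aγ` are removed by taking the limit. -/
def xi (z : ℂ) : H :=
  if z ∈ relSpectrum M.Aγ then Filter.limUnder (𝓝[≠] z) M.xiAux else M.xiAux z

/-- The map `Φ`, `(Φφ)(z) = ⟪ξ(z̄), φ⟫` (the inner product is antilinear in its first argument). -/
def Phi : H →ₗ[ℂ] (ℂ → ℂ) where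
  toFun φ := fun z => inner ℂ (M.xi (conj z)) φ
  map_add' φ η := by
    funext z
    exact inner_add_right _ _ _
  map_smul' c φ := by
    funext z
    exact inner_smul_right _ _ _

/-- The space of functions `Ĥ = ΦH`. (Its Hilbert space structure is the one transported from
`H` by the bijection `Φ : H → Ĥ`.) -/
def space : Submodule ℂ (ℂ → ℂ) :=
  LinearMap.range M.Phi

end ModelData

/-- The set of `n`-associated functions `B + zB + ⋯ + zⁿB` of a linear space `B` of functions. -/
def assocFunctions (n : ℕ) (B : Submodule ℂ (ℂ → ℂ)) : Set (ℂ → ℂ) :=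
  {m | ∃ f : Fin (n + 1) → ℂ → ℂ, (∀ k, f k ∈ B) ∧
    ∀ z : ℂ, m z = ∑ k : Fin (n + 1), z ^ (k : ℕ) * f k z}

end NEntire

end

namespace NEntire

section

variable {H : Type*} [NormedAddCommGroup H] [InnerProductSpace ℂ H]

/-! Regularity makes `ran(A - zI)` closed, with orthogonal complement `ker(A* - z̄I)`. If that
kernel is the line through `ξ(z̄) ≠ 0`, then `g` spans a complement of the range exactly when
`(Φg)(z) ≠ 0` (`isCompl_ranShift_iff`). Taking `g = ∑ zᵏ μₖ`, linearity of `Φ` identifies gauges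
`μₖ` with zero-free functions `∑ zᵏ Φμₖ`, which are entire because `ξ` is.

The work is to show that `ξ(z)` is nonzero and spans `ker(A* - zI)` for every `z`
(`kerShift_eq_span_xi`). Off the spectrum of `Aγ`, the invertible operator `I + (z - v)(Aγ - zI)⁻¹`
carries `ψ` into the kernel, a line by the deficiency condition. Spectral points are zeros of `h`,
hence isolated; normality of the resolvent makes them simple poles with nonzero residue `P`
(`exists_tendsto_residue`), and `ξ(l) = h'(l)(l - v)Pψ`. This is nonzero because an eigenvector of
`Aγ` orthogonal to `ψ` would be an eigenvector of `A`, which regularity forbids. -/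

theorem mem_adjoint_iff' {G : Submodule ℂ (H × H)} {p : H × H} :
    p ∈ G.adjoint ↔ ∀ q ∈ G, inner ℂ q.2 p.1 = inner ℂ q.1 p.2 := by
  obtain ⟨x, y⟩ := p
  rw [Submodule.mem_adjoint_iff]
  constructor
  · intro h q hq
    exact sub_eq_zero.1 (h q.1 q.2 hq)
  · intro h a b hab
    exact sub_eq_zero.2 (h (a, b) hab)

theorem isClosed_adjoint (G : Submodule ℂ (H × H)) : IsClosed (G.adjoint : Set (H × H)) := by
  have : (G.adjoint : Set (H × H)) =
      ⋂ q ∈ G, {p : H × H | inner ℂ q.2 p.1 = inner ℂ q.1 p.2} := by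
    ext p
    simp only [SetLike.mem_coe, mem_adjoint_iff', Set.mem_iInter, Set.mem_ofPred_eq]
  rw [this]
  refine isClosed_biInter fun q _ => isClosed_eq ?_ ?_ <;> fun_prop

theorem adjoint_anti {G K : Submodule ℂ (H × H)} (h : G ≤ K) : K.adjoint ≤ G.adjoint :=
  fun _ hp => mem_adjoint_iff'.2 fun q hq => mem_adjoint_iff'.1 hp q (h hq)

/-! ### Shifted ranges and resolvent algebra of linear relations. -/

/-- The map `(x, y) ↦ y - z x` on a linear relation; its range is `ran(G - zI)`. -/
def shiftMap (G : Submodule ℂ (H × H)) (z : ℂ) : G →L[ℂ] H :=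
  (ContinuousLinearMap.snd ℂ H H - z • ContinuousLinearMap.fst ℂ H H).comp G.subtypeL

@[simp]
theorem shiftMap_apply (G : Submodule ℂ (H × H)) (z : ℂ) (p : G) :
    shiftMap G z p = p.1.2 - z • p.1.1 := rfl

theorem ranShift_eq_range_shiftMap (A : H →ₗ.[ℂ] H) (z : ℂ) :
    ranShift A z = LinearMap.range (shiftMap A.graph z : A.graph →ₗ[ℂ] H) := by
  ext y
  constructor
  · rintro ⟨x, rfl⟩
    exact ⟨⟨_, A.mem_graph x⟩, rfl⟩
  · rintro ⟨⟨⟨a, b⟩, hp⟩, rfl⟩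
    obtain ⟨x, hx, hy⟩ := (LinearPMap.mem_graph_iff A).1 hp
    dsimp only at hx hy
    subst hx hy
    exact ⟨x, rfl⟩

/-- A closed relation bounded below at `z` has closed `ran(G - zI)`. -/
theorem isClosed_range_shiftMap [CompleteSpace H] {G : Submodule ℂ (H × H)}
    (hG : IsClosed (G : Set (H × H))) {z : ℂ} {d : ℝ} (hd : 0 < d)
    (h : ∀ p ∈ G, d * ‖p.1‖ ≤ ‖p.2 - z • p.1‖) :
    IsClosed (LinearMap.range (shiftMap G z : G →ₗ[ℂ] H) : Set H) := by
  have : CompleteSpace G := hG.completeSpace_coe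
  have hK : 0 ≤ 1 + (‖z‖ + 1) / d := by positivity
  -- With `N = ‖y - zx‖`, the bounds `‖x‖ ≤ N/d` and `‖y‖ ≤ N + ‖z‖‖x‖` control both coordinates.
  have anti : AntilipschitzWith (1 + (‖z‖ + 1) / d).toNNReal (shiftMap G z) := by
    refine AddMonoidHomClass.antilipschitz_of_bound _ fun p => ?_
    obtain ⟨⟨x, y⟩, hp⟩ := p
    have h1 := h _ hp
    rw [shiftMap_apply, Real.coe_toNNReal _ hK]
    change max ‖x‖ ‖y‖ ≤ _
    dsimp only at h1 ⊢
    set N := ‖y - z • x‖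
    have hx : ‖x‖ ≤ N / d := by rw [le_div_iff₀ hd]; linarith
    have hy : ‖y‖ ≤ N + ‖z‖ * ‖x‖ := by
      calc ‖y‖ = ‖(y - z • x) + z • x‖ := by rw [sub_add_cancel]
        _ ≤ _ := (norm_add_le _ _).trans (by rw [norm_smul])
    have hN : 0 ≤ N := norm_nonneg _
    have e : (1 + (‖z‖ + 1) / d) * N = N + ‖z‖ * (N / d) + N / d := by ring
    have h2 : ‖z‖ * ‖x‖ ≤ ‖z‖ * (N / d) := by gcongr
    have h3 : 0 ≤ N / d := by positivity
    have h4 : 0 ≤ ‖z‖ * (N / d) := by positivity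
    rw [e]
    exact max_le (by linarith) (by linarith)
  have := anti.isClosed_range (shiftMap G z).uniformContinuous
  exact this

theorem relResolvent_spec {B : Submodule ℂ (H × H)} {z : ℂ} (hz : z ∉ relSpectrum B) :
    IsResolvent B z (relResolvent B z) := by
  have h : ∃ R : H →L[ℂ] H, IsResolvent B z R := not_not.1 hz
  rw [relResolvent, dif_pos h]
  exact h.choose_spec

theorem relResolvent_mem {B : Submodule ℂ (H × H)} {z : ℂ} (hz : z ∉ relSpectrum B) (f : H) :
    (relResolvent B z f, f + z • relResolvent B z f) ∈ B :=
  (relResolvent_spec hz f _).2 rfl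

theorem relResolvent_apply_of_mem {B : Submodule ℂ (H × H)} {z : ℂ} (hz : z ∉ relSpectrum B)
    {x y : H} (h : (x, y) ∈ B) : relResolvent B z (y - z • x) = x :=
  ((relResolvent_spec hz _ x).1 (by rwa [sub_add_cancel])).symm

theorem resolvent_identity {B : Submodule ℂ (H × H)} {z w : ℂ} (hz : z ∉ relSpectrum B)
    (hw : w ∉ relSpectrum B) :
    relResolvent B z - relResolvent B w = (z - w) • (relResolvent B z * relResolvent B w) := by
  ext f
  have h := relResolvent_apply_of_mem hz (relResolvent_mem hw f)
  have e : f + w • relResolvent B w f - z • relResolvent B w f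
      = f - (z - w) • relResolvent B w f := by module
  rw [e, map_sub, map_smul] at h
  simp only [sub_apply, smul_apply, mul_apply_eq_comp]
  rw [← sub_eq_zero]
  rw [← sub_eq_zero] at h
  rw [← h]
  abel

theorem commute_relResolvent {B : Submodule ℂ (H × H)} {z w : ℂ} (hz : z ∉ relSpectrum B)
    (hw : w ∉ relSpectrum B) : Commute (relResolvent B z) (relResolvent B w) := by
  rcases eq_or_ne z w with rfl | hne
  · rfl
  have h1 := resolvent_identity hz hw
  have h2 := resolvent_identity hw hz
  have h3 : (z - w) • (relResolvent B z * relResolvent B w)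
      = (z - w) • (relResolvent B w * relResolvent B z) := by
    rw [← h1, ← neg_sub (relResolvent B w), h2, ← neg_smul, neg_sub]
  exact smul_right_injective _ (sub_ne_zero.2 hne) h3

/-- `I + (z - w)(B - zI)⁻¹`, which maps `ker(A* - wI)` to `ker(A* - zI)`. -/
theorem one_add_mul_one_add {B : Submodule ℂ (H × H)} {z w : ℂ} (hz : z ∉ relSpectrum B)
    (hw : w ∉ relSpectrum B) :
    (1 + (z - w) • relResolvent B z) * (1 + (w - z) • relResolvent B w) = 1 := by
  have h1 := resolvent_identity hz hw
  have : (1 + (z - w) • relResolvent B z) * (1 + (w - z) • relResolvent B w)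
      = 1 + (z - w) • (relResolvent B z - relResolvent B w
        - (z - w) • (relResolvent B z * relResolvent B w)) := by
    simp only [add_mul, mul_add, one_mul, mul_one, smul_mul_smul_comm, smul_sub, smul_smul,
      ← neg_sub z w, neg_smul, mul_neg]
    abel
  rw [this, h1, sub_self, smul_zero, add_zero]

theorem isUnit_one_add {B : Submodule ℂ (H × H)} {z w : ℂ} (hz : z ∉ relSpectrum B)
    (hw : w ∉ relSpectrum B) : IsUnit (1 + (z - w) • relResolvent B z) :=
  ⟨⟨_, _, one_add_mul_one_add hz hw, one_add_mul_one_add hw hz⟩, rfl⟩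

theorem mem_kerShift {B : Submodule ℂ (H × H)} {z : ℂ} {x : H} :
    x ∈ kerShift B z ↔ (x, z • x) ∈ B := Iff.rfl

/-! ### Selfadjoint relations: the spectrum is real. -/

section SelfAdjoint

variable {B : Submodule ℂ (H × H)}

theorem inner_symm_of_adjoint (hB : B.adjoint = B) {p q : H × H} (hp : p ∈ B) (hq : q ∈ B) :
    inner ℂ q.2 p.1 = inner ℂ q.1 p.2 := by
  rw [← hB] at hp
  exact mem_adjoint_iff'.1 hp q hq

/-- Since `⟪x, y⟫` is real, `⟪x, y - zx⟫` has imaginary part `-(Im z)‖x‖²`; Cauchy–Schwarz does the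
rest. -/
theorem abs_im_mul_norm_le (hB : B.adjoint = B) (z : ℂ) {p : H × H} (hp : p ∈ B) :
    |z.im| * ‖p.1‖ ≤ ‖p.2 - z • p.1‖ := by
  obtain ⟨x, y⟩ := p
  have h := inner_symm_of_adjoint hB hp hp
  dsimp only at h ⊢
  rcases eq_or_ne x 0 with rfl | hx
  · simp
  have h1 : (inner ℂ x y : ℂ).im = 0 := by
    rw [← inner_conj_symm] at h
    exact Complex.conj_eq_iff_im.1 h
  have h2 : (inner ℂ x (y - z • x) : ℂ).im = - (z.im * ‖x‖ ^ 2) := by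
    rw [inner_sub_right, inner_smul_right, inner_self_eq_norm_sq_to_K, Complex.sub_im, h1,
      zero_sub]
    change -(z * (‖x‖ : ℂ) ^ 2).im = _
    rw [← Complex.ofReal_pow, Complex.im_mul_ofReal]
  have h3 : |z.im| * ‖x‖ ^ 2 ≤ ‖x‖ * ‖y - z • x‖ := by
    calc |z.im| * ‖x‖ ^ 2 = |(inner ℂ x (y - z • x) : ℂ).im| := by
          rw [h2, abs_neg, abs_mul, abs_of_nonneg (sq_nonneg ‖x‖)]
      _ ≤ ‖(inner ℂ x (y - z • x) : ℂ)‖ := Complex.abs_im_le_norm _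
      _ ≤ _ := norm_inner_le_norm _ _
  have hx0 : 0 < ‖x‖ := norm_pos_iff.2 hx
  nlinarith

theorem notMem_relSpectrum_of_im_ne_zero [CompleteSpace H] (hB : B.adjoint = B) {z : ℂ}
    (hz : z.im ≠ 0) : z ∉ relSpectrum B := by
  have hBc : IsClosed (B : Set (H × H)) := hB ▸ isClosed_adjoint B
  have : CompleteSpace B := hBc.completeSpace_coe
  have hcl := isClosed_range_shiftMap hBc (abs_pos.2 hz) fun p hp => abs_im_mul_norm_le hB z hp
  have hinj : LinearMap.ker (shiftMap B z : B →ₗ[ℂ] H) = ⊥ := by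
    refine LinearMap.ker_eq_bot'.2 fun p hp => ?_
    have h1 := abs_im_mul_norm_le hB z p.2
    have h0 : p.1.2 - z • p.1.1 = 0 := hp
    rw [h0, norm_zero] at h1
    have h2 : p.1.1 = 0 := by
      by_contra hne
      exact absurd h1 (not_le.2 (mul_pos (abs_pos.2 hz) (norm_pos_iff.2 hne)))
    rw [h2, smul_zero, sub_zero] at h0
    exact Subtype.ext (Prod.ext h2 h0)
  have hsurj : LinearMap.range (shiftMap B z : B →ₗ[ℂ] H) = ⊤ := by
    have := hcl.completeSpace_coe
    rw [← Submodule.orthogonal_eq_bot_iff, Submodule.eq_bot_iff]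
    intro θ hθ
    -- A vector orthogonal to the range is an eigenvector at `z̄`, which the same lower bound
    -- excludes.
    have hmem : (θ, conj z • θ) ∈ B := by
      rw [← hB, mem_adjoint_iff']
      intro q hq
      have := (Submodule.mem_orthogonal _ _).1 hθ _ ⟨⟨q, hq⟩, rfl⟩
      simp only [ContinuousLinearMap.coe_coe, shiftMap_apply, inner_sub_left,
        inner_smul_left] at this
      rw [inner_smul_right]
      exact sub_eq_zero.1 this
    have h1 := abs_im_mul_norm_le hB (conj z) hmem
    simp only [sub_self, norm_zero, Complex.conj_im, abs_neg] at h1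
    by_contra hne
    exact absurd h1 (not_le.2 (mul_pos (abs_pos.2 hz) (norm_pos_iff.2 hne)))
  let e := ContinuousLinearEquiv.ofBijective (shiftMap B z) hinj hsurj
  have he : ∀ p, e p = shiftMap B z p := fun _ => rfl
  refine not_not.2 ⟨(ContinuousLinearMap.fst ℂ H H).comp
    (B.subtypeL.comp (e.symm : H →L[ℂ] B)), fun φ η => ?_⟩
  constructor
  · intro h
    have h1 : e ⟨_, h⟩ = φ := by simp [he]
    have h2 := e.symm_apply_apply ⟨_, h⟩
    rw [h1] at h2
    simp [h2]
  · rintro rfl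
    have h1 : e (e.symm φ) = φ := e.apply_symm_apply φ
    rw [he, shiftMap_apply, sub_eq_iff_eq_add] at h1
    have h2 : ((e.symm φ : H × H).1, φ + z • (e.symm φ : H × H).1) ∈ B := by
      rw [← h1]; exact (e.symm φ).2
    exact h2

end SelfAdjoint

end

/-! ### Resolvents of selfadjoint relations: normality, holomorphy, residues. -/

section

variable {H : Type*} [NormedAddCommGroup H] [InnerProductSpace ℂ H] [CompleteSpace H]
  {B : Submodule ℂ (H × H)}

theorem conj_eq_of_mem_relSpectrum (hB : B.adjoint = B) {z : ℂ} (hz : z ∈ relSpectrum B) :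
    conj z = z := by
  refine Complex.conj_eq_iff_im.2 ?_
  by_contra h
  exact notMem_relSpectrum_of_im_ne_zero hB h hz

theorem conj_notMem_relSpectrum (hB : B.adjoint = B) {z : ℂ} (hz : z ∉ relSpectrum B) :
    conj z ∉ relSpectrum B := fun h => hz (by
  have := conj_eq_of_mem_relSpectrum hB h
  rw [Complex.conj_conj] at this
  rwa [this])

theorem star_relResolvent (hB : B.adjoint = B) {z : ℂ} (hz : z ∉ relSpectrum B) :
    star (relResolvent B z) = relResolvent B (conj z) := by
  rw [ContinuousLinearMap.star_eq_adjoint]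
  symm
  rw [ContinuousLinearMap.eq_adjoint_iff]
  intro f g
  have h := inner_symm_of_adjoint hB (relResolvent_mem hz g)
    (relResolvent_mem (conj_notMem_relSpectrum hB hz) f)
  simp only [inner_add_left, inner_add_right, inner_smul_left, inner_smul_right,
    Complex.conj_conj] at h
  exact (add_right_cancel h).symm

theorem isStarNormal_relResolvent (hB : B.adjoint = B) {z : ℂ} (hz : z ∉ relSpectrum B) :
    IsStarNormal (relResolvent B z) :=
  ⟨by
    rw [star_relResolvent hB hz]
    exact commute_relResolvent (conj_notMem_relSpectrum hB hz) hz⟩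

/-- The resolvent of a selfadjoint relation is bounded by the inverse distance to the spectrum. -/
theorem norm_relResolvent_le (hB : B.adjoint = B) {z : ℂ} (hz : z ∉ relSpectrum B) {δ : ℝ}
    (hδ : 0 < δ) (h : ∀ μ ∈ relSpectrum B, δ ≤ ‖μ - z‖) : ‖relResolvent B z‖ ≤ δ⁻¹ := by
  have := isStarNormal_relResolvent hB hz
  have key : spectralRadius ℂ (relResolvent B z) ≤ (δ⁻¹.toNNReal : ENNReal) := by
    refine iSup₂_le fun k hk => ?_
    rw [ENNReal.coe_le_coe, ← NNReal.coe_le_coe, Real.coe_toNNReal _ (by positivity), coe_nnnorm]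
    by_contra! hlt
    have hk0 : k ≠ 0 := by
      rintro rfl
      rw [norm_zero] at hlt
      exact absurd hlt (not_lt.2 (by positivity))
    -- The point `z + k⁻¹` lies closer to `z` than `δ`, so it is off the spectrum; this makes `k -
    -- R(z) = k(1 - k⁻¹R(z))` invertible.
    have hw : z + k⁻¹ ∉ relSpectrum B := fun hmem => by
      have h1 := h _ hmem
      rw [add_sub_cancel_left, norm_inv] at h1
      exact absurd ((inv_lt_comm₀ hδ (norm_pos_iff.2 hk0)).1 hlt) (not_lt.2 h1)
    have hu := isUnit_one_add hz hw
    rw [spectrum.mem_iff] at hk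
    apply hk
    have e : algebraMap ℂ (H →L[ℂ] H) k - relResolvent B z
        = algebraMap ℂ (H →L[ℂ] H) k * (1 + (z - (z + k⁻¹)) • relResolvent B z) := by
      rw [← Algebra.smul_def, smul_add, smul_smul, Algebra.algebraMap_eq_smul_one]
      have : k * (z - (z + k⁻¹)) = -1 := by field_simp; ring
      rw [this, neg_one_smul, sub_eq_add_neg]
    rw [e]
    exact ((isUnit_iff_ne_zero.2 hk0).map (algebraMap ℂ (H →L[ℂ] H))).mul hu
  rw [IsStarNormal.spectralRadius_eq_nnnorm, ENNReal.coe_le_coe, ← NNReal.coe_le_coe,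
    Real.coe_toNNReal _ (by positivity), coe_nnnorm] at key
  exact key

/-- Near `w` the resolvent identity gives `R(z) = R(w)(1 + (w - z)R(w))⁻¹`, and inversion is
holomorphic. -/
theorem differentiableAt_relResolvent {w : ℂ}
    (hw : ∀ᶠ z in 𝓝 w, z ∉ relSpectrum B) :
    DifferentiableAt ℂ (relResolvent B) w := by
  have hw0 := hw.self_of_nhds
  have heq : relResolvent B =ᶠ[𝓝 w] fun z =>
      relResolvent B w * Ring.inverse (1 + (w - z) • relResolvent B w) := by
    filter_upwards [hw] with z hz
    have hu := isUnit_one_add hw0 hz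
    have h1 := resolvent_identity hz hw0
    have h2 : relResolvent B z * (1 + (w - z) • relResolvent B w) = relResolvent B w := by
      rw [mul_add, mul_one, mul_smul_comm, ← neg_sub z w, neg_smul, ← h1]
      abel
    calc relResolvent B z = relResolvent B z * (1 + (w - z) • relResolvent B w)
          * Ring.inverse (1 + (w - z) • relResolvent B w) := by
            rw [mul_assoc, Ring.mul_inverse_cancel _ hu, mul_one]
      _ = _ := by rw [h2]
  refine DifferentiableAt.congr_of_eventuallyEq ?_ heq
  have hd : DifferentiableAt ℂ (fun z : ℂ => (1 : H →L[ℂ] H) + (w - z) • relResolvent B w) w := by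
    fun_prop
  have hi : DifferentiableAt ℂ Ring.inverse ((1 : H →L[ℂ] H) + (w - w) • relResolvent B w) :=
    differentiableAt_inverse (by simp)
  exact (DifferentiableAt.comp w hi hd).const_mul _

/-- The resolvent of a selfadjoint relation has a simple pole at every isolated point of the
spectrum. -/
theorem exists_tendsto_residue (hB : B.adjoint = B) {l : ℂ} (hl : l ∈ relSpectrum B)
    (hiso : ∀ᶠ z in 𝓝[≠] l, z ∉ relSpectrum B) :
    ∃ P : H →L[ℂ] H, P ≠ 0 ∧
      Filter.Tendsto (fun z => (z - l) • relResolvent B z) (𝓝[≠] l) (𝓝 P) := by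
  obtain ⟨r, hr, hball⟩ := Metric.eventually_nhds_iff.1 (eventually_nhdsWithin_iff.1 hiso)
  have hfar : ∀ μ ∈ relSpectrum B, μ ≠ l → r ≤ ‖μ - l‖ := by
    intro μ hμ hne
    by_contra! hlt
    exact hball (by rwa [dist_eq_norm]) hne hμ
  -- Within radius `r / 2`, the point of the spectrum nearest to `z` is `l`, so `‖R(z)‖ ≤ ‖z -
  -- l‖⁻¹`, and `(z - l)R(z)` has a removable singularity.
  have hs : Metric.ball l (r / 2) ∈ 𝓝 l := Metric.ball_mem_nhds _ (by positivity)
  have hnear : ∀ z ∈ Metric.ball l (r / 2) \ {l}, z ∉ relSpectrum B := by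
    rintro z ⟨hz, hne⟩
    exact hball (lt_trans (Metric.mem_ball.1 hz) (by linarith)) hne
  have hd : DifferentiableOn ℂ (fun z => (z - l) • relResolvent B z)
      (Metric.ball l (r / 2) \ {l}) := by
    intro z hz
    have hopen : IsOpen (Metric.ball l (r / 2) \ {l}) := Metric.isOpen_ball.sdiff isClosed_singleton
    have : DifferentiableAt ℂ (relResolvent B) z :=
      differentiableAt_relResolvent (Filter.mem_of_superset (hopen.mem_nhds hz) hnear)
    exact ((differentiableAt_id.sub_const l).smul this).differentiableWithinAt
  have hb : BddAbove (norm ∘ (fun z => (z - l) • relResolvent B z) ''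
      (Metric.ball l (r / 2) \ {l})) := by
    refine ⟨1, ?_⟩
    rintro _ ⟨z, hz, rfl⟩
    have hzl : 0 < ‖z - l‖ := norm_pos_iff.2 (sub_ne_zero.2 hz.2)
    have hzr : ‖z - l‖ < r / 2 := by simpa [dist_eq_norm] using hz.1
    have := norm_relResolvent_le hB (hnear z hz) hzl fun μ hμ => by
      rcases eq_or_ne μ l with rfl | hne
      · rw [norm_sub_rev]
      · have h1 := hfar μ hμ hne
        have h2 := norm_sub_le_norm_sub_add_norm_sub μ z l
        linarith
    simp only [Function.comp_apply, norm_smul]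
    calc ‖z - l‖ * ‖relResolvent B z‖ ≤ ‖z - l‖ * ‖z - l‖⁻¹ := by gcongr
      _ = 1 := mul_inv_cancel₀ hzl.ne'
  set P := Filter.limUnder (𝓝[≠] l) (fun z => (z - l) • relResolvent B z) with hP
  have hG := Complex.differentiableOn_update_limUnder_of_bddAbove hs hd hb
  rw [← hP] at hG
  have hGd := hG.differentiableAt hs
  set G := Function.update (fun z => (z - l) • relResolvent B z) l P with hGdef
  have hGl : G l = P := Function.update_self ..
  have hGz : ∀ z, z ≠ l → G z = (z - l) • relResolvent B z := fun z hz =>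
    Function.update_of_ne hz ..
  have hlim : Filter.Tendsto (fun z => (z - l) • relResolvent B z) (𝓝[≠] l) (𝓝 P) := by
    have h1 : Filter.Tendsto G (𝓝[≠] l) (𝓝 P) := by
      rw [← hGl]
      exact hGd.continuousAt.tendsto.mono_left nhdsWithin_le_nhds
    refine h1.congr' ?_
    filter_upwards [self_mem_nhdsWithin] with z hz using hGz z hz
  refine ⟨P, fun hP0 => ?_, hlim⟩
  -- If the residue vanished, `R(z)` would converge to some `Q`; closedness of `B` would make `Q` a
  -- resolvent at `l`, contradicting `l ∈ Sp(B)`.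
  have hQ : Filter.Tendsto (relResolvent B) (𝓝[≠] l) (𝓝 (dslope G l l)) := by
    have h1 := (continuousAt_dslope_same.2 hGd).tendsto.mono_left
      (nhdsWithin_le_nhds (s := {l}ᶜ))
    refine h1.congr' ?_
    filter_upwards [self_mem_nhdsWithin] with z hz
    have hz' : z - l ≠ 0 := sub_ne_zero.2 hz
    rw [dslope_of_ne _ hz, slope_def_module, hGl, hP0, sub_zero, hGz z hz, smul_smul,
      inv_mul_cancel₀ hz', one_smul]
  set Q := dslope G l l
  have hQf : ∀ {f : ℂ → H} {f₀ : H}, Filter.Tendsto f (𝓝[≠] l) (𝓝 f₀) →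
      Filter.Tendsto (fun z => relResolvent B z (f z)) (𝓝[≠] l) (𝓝 (Q f₀)) := fun hf =>
    isBoundedBilinearMap_apply.continuous.tendsto (Q, _) |>.comp (hQ.prodMk_nhds hf)
  have hid : Filter.Tendsto (fun z : ℂ => z) (𝓝[≠] l) (𝓝 l) := nhdsWithin_le_nhds
  refine hl ⟨Q, fun φ η => ⟨fun hmem => ?_, ?_⟩⟩
  · have h1 : Filter.Tendsto (fun z => φ + l • η - z • η) (𝓝[≠] l) (𝓝 (φ + l • η - l • η)) :=
      tendsto_const_nhds.sub (hid.smul_const η)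
    rw [add_sub_cancel_right] at h1
    refine tendsto_nhds_unique (tendsto_const_nhds.congr' ?_) (hQf h1)
    filter_upwards [hiso] with z hz using (relResolvent_apply_of_mem hz hmem).symm
  · rintro rfl
    have hBc : IsClosed (B : Set (H × H)) := hB ▸ isClosed_adjoint B
    have h1 := hQf (tendsto_const_nhds (x := φ))
    refine hBc.mem_of_tendsto (h1.prodMk_nhds (tendsto_const_nhds.add (hid.smul h1))) ?_
    filter_upwards [hiso] with z hz using relResolvent_mem hz φ

omit [CompleteSpace H] in
/-- The residue of the resolvent maps into the eigenspace. -/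
theorem residue_mem (hB : B.adjoint = B) {l : ℂ}
    (hiso : ∀ᶠ z in 𝓝[≠] l, z ∉ relSpectrum B) {P : H →L[ℂ] H}
    (hP : Filter.Tendsto (fun z => (z - l) • relResolvent B z) (𝓝[≠] l) (𝓝 P)) (f : H) :
    (P f, l • P f) ∈ B := by
  have hBc : IsClosed (B : Set (H × H)) := hB ▸ isClosed_adjoint B
  have hid : Filter.Tendsto (fun z : ℂ => z) (𝓝[≠] l) (𝓝 l) := nhdsWithin_le_nhds
  have h1 : Filter.Tendsto (fun z => (z - l) • relResolvent B z f) (𝓝[≠] l) (𝓝 (P f)) :=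
    ((ContinuousLinearMap.apply ℂ H f).continuous.tendsto P).comp hP
  have h2 : Filter.Tendsto (fun z => (z - l) • f + z • (z - l) • relResolvent B z f) (𝓝[≠] l)
      (𝓝 ((l - l) • f + l • P f)) := ((hid.sub_const l).smul_const f).add (hid.smul h1)
  rw [sub_self, zero_smul, zero_add] at h2
  refine hBc.mem_of_tendsto (h1.prodMk_nhds h2) ?_
  filter_upwards [hiso] with z hz
  have := B.smul_mem (z - l) (relResolvent_mem hz f)
  rwa [Prod.smul_mk, smul_add, smul_comm] at this

end

/-! ### Defect spaces of `A`. -/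

section

variable {H : Type*} [NormedAddCommGroup H] [InnerProductSpace ℂ H] {A : H →ₗ.[ℂ] H}

theorem mem_kerShift_adjointRel {z : ℂ} {θ : H} :
    θ ∈ kerShift (adjointRel A) z ↔ ∀ q ∈ A.graph, inner ℂ q.2 θ = inner ℂ q.1 (z • θ) :=
  mem_adjoint_iff'

theorem orthogonal_ranShift (A : H →ₗ.[ℂ] H) (z : ℂ) :
    (ranShift A z)ᗮ = kerShift (adjointRel A) (conj z) := by
  ext θ
  rw [mem_kerShift_adjointRel, Submodule.mem_orthogonal, ranShift_eq_range_shiftMap]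
  have key : ∀ q : H × H, inner ℂ (q.2 - z • q.1) θ = 0 ↔
      inner ℂ q.2 θ = inner ℂ q.1 (conj z • θ) := fun q => by
    rw [inner_sub_left, inner_smul_left, inner_smul_right, sub_eq_zero]
  constructor
  · exact fun h q hq => (key q).1 (h _ ⟨⟨q, hq⟩, rfl⟩)
  · rintro h _ ⟨⟨q, hq⟩, rfl⟩
    exact (key q).2 (h q hq)

theorem mem_adjointRel_of_isExtension {B : Submodule ℂ (H × H)}
    (hB : IsCanonicalSelfAdjointExtension A B) {p : H × H} (hp : p ∈ B) : p ∈ adjointRel A := by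
  rw [← hB.2] at hp
  exact adjoint_anti hB.1 hp

/-- In `A*`, add `(z - w)(Rθ, θ + zRθ)` to `(θ, wθ)`: the second coordinate becomes `z` times the
first. -/
theorem one_add_resolvent_mem_kerShift {B : Submodule ℂ (H × H)}
    (hB : IsCanonicalSelfAdjointExtension A B) {z w : ℂ} (hz : z ∉ relSpectrum B) {θ : H}
    (hθ : θ ∈ kerShift (adjointRel A) w) :
    (1 + (z - w) • relResolvent B z) θ ∈ kerShift (adjointRel A) z := by
  have h1 := mem_adjointRel_of_isExtension hB (relResolvent_mem hz θ)
  have h2 := (adjointRel A).add_mem (mem_kerShift.1 hθ) ((adjointRel A).smul_mem (z - w) h1)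
  rw [mem_kerShift]
  convert h2 using 1
  refine Prod.ext rfl ?_
  simp only [add_apply, one_apply_eq_self, smul_apply, Prod.snd_add, Prod.smul_snd]
  module

theorem one_add_resolvent_apply_cancel {B : Submodule ℂ (H × H)} {z w : ℂ}
    (hz : z ∉ relSpectrum B) (hw : w ∉ relSpectrum B) (θ : H) :
    (1 + (z - w) • relResolvent B z) ((1 + (w - z) • relResolvent B w) θ) = θ := by
  rw [← mul_apply_eq_comp, one_add_mul_one_add hz hw, one_apply_eq_self]

variable [CompleteSpace H]

theorem InClassS.isClosed_ranShift (hA : InClassS A) (z : ℂ) :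
    IsClosed (ranShift A z : Set H) := by
  obtain ⟨d, hd, h⟩ := hA.regular z
  rw [ranShift_eq_range_shiftMap]
  refine isClosed_range_shiftMap hA.closed hd ?_
  rintro ⟨a, b⟩ hp
  obtain ⟨x, hx, hy⟩ := (LinearPMap.mem_graph_iff A).1 hp
  dsimp only at hx hy ⊢
  subst hx hy
  exact h x

theorem InClassS.mem_ranShift_iff (hA : InClassS A) {z : ℂ} {f : H} :
    f ∈ ranShift A z ↔ ∀ θ ∈ kerShift (adjointRel A) (conj z), inner ℂ θ f = 0 := by
  have := (hA.isClosed_ranShift z).completeSpace_coe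
  rw [← Submodule.mem_orthogonal, ← orthogonal_ranShift, Submodule.orthogonal_orthogonal]

omit [CompleteSpace H] in
theorem InClassS.eq_zero_of_mem_graph (hA : InClassS A) {z : ℂ} {a : H}
    (h : (a, z • a) ∈ A.graph) : a = 0 := by
  obtain ⟨d, hd, hr⟩ := hA.regular z
  obtain ⟨x, hx, hy⟩ := (LinearPMap.mem_graph_iff A).1 h
  dsimp only at hx hy
  have h1 := hr x
  rw [hx, hy, sub_self, norm_zero] at h1
  by_contra hne
  exact absurd h1 (not_le.2 (mul_pos hd (norm_pos_iff.2 hne)))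

/-- The defect spaces off the spectrum of a canonical selfadjoint extension are lines. -/
theorem InClassS.exists_smul_eq (hA : InClassS A) {B : Submodule ℂ (H × H)}
    (hB : IsCanonicalSelfAdjointExtension A B) {z : ℂ} (hz : z ∉ relSpectrum B) {ψ θ : H}
    (hψ : ψ ∈ kerShift (adjointRel A) z) (hψ0 : ψ ≠ 0) (hθ : θ ∈ kerShift (adjointRel A) z) :
    ∃ c : ℂ, c • ψ = θ := by
  -- Both vectors are transported to the defect space at `i`, whose dimension is known to be one,
  -- and back.
  have hI : Complex.I ∉ relSpectrum B := notMem_relSpectrum_of_im_ne_zero hB.2 (by simp)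
  have hψ' := one_add_resolvent_mem_kerShift hB hI hψ
  have hθ' := one_add_resolvent_mem_kerShift hB hI hθ
  have cψ := one_add_resolvent_apply_cancel hz hI ψ
  have cθ := one_add_resolvent_apply_cancel hz hI θ
  have hne : (⟨_, hψ'⟩ : kerShift (adjointRel A) Complex.I) ≠ 0 := fun h0 => by
    have h1 : (1 + (Complex.I - z) • relResolvent B Complex.I) ψ = 0 := Subtype.ext_iff.1 h0
    rw [h1, map_zero] at cψ
    exact hψ0 cψ.symm
  obtain ⟨c, hc⟩ := (finrank_eq_one_iff_of_nonzero' _ hne).1 hA.deficiency_upper ⟨_, hθ'⟩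
  refine ⟨c, ?_⟩
  have hc' := Subtype.ext_iff.1 hc
  dsimp only [SetLike.val_smul] at hc'
  rw [← cψ, ← cθ, ← hc', map_smul, cψ]

/-! ### The functional model: `ξ` is entire and spans every defect space. -/

namespace ModelData

variable (M : ModelData A)

omit [CompleteSpace H] in
theorem xiAux_eq (z : ℂ) :
    M.xiAux z = M.h z • (1 + (z - (M.v : ℂ)) • relResolvent M.Aγ z) M.ψ := rfl

omit [CompleteSpace H] in
theorem eventually_notMem_nhds {w : ℂ} (hw : w ∉ relSpectrum M.Aγ) :
    ∀ᶠ z in 𝓝 w, z ∉ relSpectrum M.Aγ := by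
  have h0 : M.h w ≠ 0 := fun h => hw ((M.h_zero_iff w).1 h)
  filter_upwards [M.h_entire.continuous.continuousAt.eventually_ne h0] with z hz hmem
  exact hz ((M.h_zero_iff z).2 hmem)

omit [CompleteSpace H] in
theorem eventually_notMem_nhdsNE {l : ℂ} (hl : l ∈ relSpectrum M.Aγ) :
    ∀ᶠ z in 𝓝[≠] l, z ∉ relSpectrum M.Aγ := by
  have h0 := (M.h_zero_iff l).2 hl
  filter_upwards [(M.h_entire l).hasDerivAt.eventually_ne (M.h_simple l h0) (c := 0)] with z hz hmem
  exact hz ((M.h_zero_iff z).2 hmem)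

omit [CompleteSpace H] in
theorem xi_of_notMem {z : ℂ} (hz : z ∉ relSpectrum M.Aγ) :
    M.xi z = M.h z • (1 + (z - (M.v : ℂ)) • relResolvent M.Aγ z) M.ψ := by
  rw [xi, if_neg hz, xiAux_eq]

omit [CompleteSpace H] in
theorem tendsto_h_div {l : ℂ} (hl : l ∈ relSpectrum M.Aγ) :
    Filter.Tendsto (fun z => (z - l)⁻¹ * M.h z) (𝓝[≠] l) (𝓝 (deriv M.h l)) := by
  have := hasDerivAt_iff_tendsto_slope.1 (M.h_entire l).hasDerivAt
  refine this.congr fun z => ?_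
  rw [slope_def_module, (M.h_zero_iff l).2 hl, sub_zero, smul_eq_mul]

omit [CompleteSpace H] in
/-- At a point `l` of the spectrum, `ξ` takes the value `h'(l) (l - v) P ψ`, where `P` is the
residue of the resolvent. -/
theorem tendsto_xiAux {l : ℂ} (hl : l ∈ relSpectrum M.Aγ) {P : H →L[ℂ] H}
    (hP : Filter.Tendsto (fun z => (z - l) • relResolvent M.Aγ z) (𝓝[≠] l) (𝓝 P)) :
    Filter.Tendsto M.xiAux (𝓝[≠] l) (𝓝 (deriv M.h l • (l - (M.v : ℂ)) • P M.ψ)) := by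
  have hid : Filter.Tendsto (fun z : ℂ => z) (𝓝[≠] l) (𝓝 l) := nhdsWithin_le_nhds
  have h1 : Filter.Tendsto (fun z => (z - l) • relResolvent M.Aγ z M.ψ) (𝓝[≠] l) (𝓝 (P M.ψ)) :=
    ((ContinuousLinearMap.apply ℂ H M.ψ).continuous.tendsto P).comp hP
  have h2 := (M.tendsto_h_div hl).smul (((hid.sub_const l).smul_const M.ψ).add
    ((hid.sub_const (M.v : ℂ)).smul h1))
  rw [sub_self, zero_smul, zero_add] at h2
  refine h2.congr' ?_
  filter_upwards [self_mem_nhdsWithin] with z hz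
  have hz' : z - l ≠ 0 := sub_ne_zero.2 hz
  rw [smul_comm (z - (M.v : ℂ)), ← smul_add, smul_smul, mul_right_comm, inv_mul_cancel₀ hz',
    one_mul]
  rfl

/-- `limUnder` is meaningful only if a limit exists; the simple zero of `h` cancelling the simple
pole of the resolvent supplies it. -/
theorem tendsto_xi {l : ℂ} (hl : l ∈ relSpectrum M.Aγ) :
    Filter.Tendsto M.xiAux (𝓝[≠] l) (𝓝 (M.xi l)) := by
  obtain ⟨P, -, hP⟩ := exists_tendsto_residue M.isExtension.2 hl (M.eventually_notMem_nhdsNE hl)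
  rw [xi, if_pos hl]
  exact tendsto_nhds_limUnder ⟨_, M.tendsto_xiAux hl hP⟩

theorem differentiableAt_xi_of_notMem {w : ℂ} (hw : w ∉ relSpectrum M.Aγ) :
    DifferentiableAt ℂ M.xi w := by
  have hR := differentiableAt_relResolvent (M.eventually_notMem_nhds hw)
  have heq : M.xi =ᶠ[𝓝 w] M.xiAux := by
    filter_upwards [M.eventually_notMem_nhds hw] with z hz
    rw [xi, if_neg hz]
  refine DifferentiableAt.congr_of_eventuallyEq ?_ heq
  have h1 : DifferentiableAt ℂ (fun z => relResolvent M.Aγ z M.ψ) w :=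
    hR.clm_apply (differentiableAt_const _)
  exact (M.h_entire w).smul
    (((differentiableAt_id.sub_const _).smul h1).const_add _)

theorem differentiable_xi : Differentiable ℂ M.xi := by
  intro w
  by_cases hw : w ∈ relSpectrum M.Aγ
  · refine (Complex.analyticAt_of_differentiable_on_punctured_nhds_of_continuousAt
      ?_ ?_).differentiableAt
    · filter_upwards [M.eventually_notMem_nhdsNE hw] with z hz
      exact M.differentiableAt_xi_of_notMem hz
    · rw [continuousAt_iff_punctured_nhds]
      refine (M.tendsto_xi hw).congr' ?_
      filter_upwards [M.eventually_notMem_nhdsNE hw] with z hz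
      rw [xi, if_neg hz]
  · exact M.differentiableAt_xi_of_notMem hw

theorem differentiable_Phi (φ : H) : Differentiable ℂ (M.Phi φ) := by
  have h1 : Differentiable ℂ (fun z => innerSL ℂ φ (M.xi z)) :=
    (innerSL ℂ φ).differentiable.comp M.differentiable_xi
  intro z
  -- Conjugating both argument and value turns the holomorphic `z ↦ ⟪φ, ξ(z)⟫` into `Φφ`.
  have h2 := (h1 (conj z)).conj_conj
  rw [Complex.conj_conj] at h2
  refine h2.congr_of_eventuallyEq (Filter.Eventually.of_forall fun w => ?_)
  exact (inner_conj_symm _ _).symm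

theorem kerShift_of_notMem (hA : InClassS A) {z : ℂ} (hz : z ∉ relSpectrum M.Aγ) :
    M.xi z ≠ 0 ∧ kerShift (adjointRel A) z = Submodule.span ℂ {M.xi z} := by
  have hh : M.h z ≠ 0 := fun h => hz ((M.h_zero_iff z).1 h)
  have hmem := one_add_resolvent_mem_kerShift M.isExtension hz M.ψ_mem
  have hne : M.xi z ≠ 0 := by
    rw [M.xi_of_notMem hz]
    refine smul_ne_zero hh fun h0 => M.ψ_ne_zero ?_
    rw [← one_add_resolvent_apply_cancel M.v_notMem hz M.ψ, h0, map_zero]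
  have hxi : M.xi z ∈ kerShift (adjointRel A) z := by
    rw [M.xi_of_notMem hz]
    exact Submodule.smul_mem _ _ hmem
  refine ⟨hne, le_antisymm (fun θ hθ => ?_) ?_⟩
  · exact Submodule.mem_span_singleton.2 (hA.exists_smul_eq M.isExtension hz hxi hne hθ)
  · rwa [Submodule.span_singleton_le_iff_mem]

/-- `A` consists of the pairs `(x, y)` of `Aγ` with `y - v x` orthogonal to `ψ`. -/
theorem mem_graph_of_inner_psi_eq_zero (hA : InClassS A) {x y : H} (hxy : (x, y) ∈ M.Aγ)
    (h : inner ℂ M.ψ (y - (M.v : ℂ) • x) = 0) : (x, y) ∈ A.graph := by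
  have hv : conj (M.v : ℂ) = M.v := Complex.conj_ofReal _
  have hran : y - (M.v : ℂ) • x ∈ ranShift A M.v := by
    rw [hA.mem_ranShift_iff, hv]
    intro θ hθ
    obtain ⟨c, rfl⟩ := hA.exists_smul_eq M.isExtension M.v_notMem M.ψ_mem M.ψ_ne_zero hθ
    rw [inner_smul_left, h, mul_zero]
  rw [ranShift_eq_range_shiftMap] at hran
  obtain ⟨⟨⟨a, b⟩, hab⟩, he⟩ := hran
  replace he : b - (M.v : ℂ) • a = y - (M.v : ℂ) • x := he
  -- Both `(a, b)` and `(x, y)` lie in `Aγ` with the same image under `Aγ - vI`, which is injective,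
  -- so they coincide.
  have h1 := relResolvent_apply_of_mem M.v_notMem hxy
  have h2 := relResolvent_apply_of_mem M.v_notMem (M.isExtension.1 hab)
  have hax : a = x := by rw [← h1, ← h2, he]
  subst hax
  rwa [← sub_left_inj.1 he]

/-- The eigenvectors of `Aγ` are not orthogonal to `ψ`. -/
theorem inner_psi_ne_zero (hA : InClassS A) {l : ℂ} {η : H}
    (hη0 : η ≠ 0) (hη : (η, l • η) ∈ M.Aγ) : inner ℂ M.ψ η ≠ 0 := by
  intro h
  refine hη0 (hA.eq_zero_of_mem_graph (M.mem_graph_of_inner_psi_eq_zero hA hη ?_))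
  rw [← sub_smul, inner_smul_right, h, mul_zero]

/-- Every eigenvector of `Aγ` spans `Aγ` over `A`. -/
theorem exists_mem_graph_add_smul (hA : InClassS A) {l : ℂ} (hl : l ∈ relSpectrum M.Aγ) {η : H}
    (hη0 : η ≠ 0) (hη : (η, l • η) ∈ M.Aγ) {x y : H} (hxy : (x, y) ∈ M.Aγ) :
    ∃ t : ℂ, (x - t • η, y - t • l • η) ∈ A.graph := by
  have hψη := M.inner_psi_ne_zero hA hη0 hη
  have hlv : l - M.v ≠ 0 := fun h => M.v_notMem (by rwa [← sub_eq_zero.1 h])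
  -- The coefficient that makes `(y - tlη) - v(x - tη)` orthogonal to `ψ`.
  refine ⟨inner ℂ M.ψ (y - (M.v : ℂ) • x) / ((l - M.v) * inner ℂ M.ψ η),
    M.mem_graph_of_inner_psi_eq_zero hA
      (M.Aγ.sub_mem hxy (M.Aγ.smul_mem _ hη)) ?_⟩
  set t := inner ℂ M.ψ (y - (M.v : ℂ) • x) / ((l - M.v) * inner ℂ M.ψ η) with ht
  have e : y - t • l • η - (M.v : ℂ) • (x - t • η)
      = (y - (M.v : ℂ) • x) - (t * (l - M.v)) • η := by module
  rw [e, inner_sub_right, inner_smul_right, ht]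
  field_simp
  ring

theorem kerShift_of_mem (hA : InClassS A) {l : ℂ} (hl : l ∈ relSpectrum M.Aγ) :
    M.xi l ≠ 0 ∧ kerShift (adjointRel A) l = Submodule.span ℂ {M.xi l} := by
  have hlc := conj_eq_of_mem_relSpectrum M.isExtension.2 hl
  have hiso := M.eventually_notMem_nhdsNE hl
  obtain ⟨P, hP0, hP⟩ := exists_tendsto_residue M.isExtension.2 hl hiso
  obtain ⟨f, hf⟩ : ∃ f, P f ≠ 0 := by
    by_contra! h
    exact hP0 (ContinuousLinearMap.ext h)
  have hη := residue_mem M.isExtension.2 hiso hP f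
  set η := P f
  have hψη := M.inner_psi_ne_zero hA hf hη
  have hlv : l - M.v ≠ 0 := fun h => M.v_notMem (by rwa [← sub_eq_zero.1 h])
  have hxi := tendsto_nhds_unique (M.tendsto_xi hl) (M.tendsto_xiAux hl hP)
  -- Symmetry of `Aγ` and `l` real give `(l - z)⟪η, R(z)ψ⟫ = ⟪η, ψ⟫`. As `⟪η, ψ⟫ ≠ 0`, this forces
  -- `Pψ ≠ 0`.
  have hPη : inner ℂ η (P M.ψ) = -inner ℂ η M.ψ := by
    have h1 : Filter.Tendsto (fun z => inner ℂ η ((z - l) • relResolvent M.Aγ z M.ψ)) (𝓝[≠] l)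
        (𝓝 (inner ℂ η (P M.ψ))) :=
      ((innerSL ℂ η).continuous.tendsto _).comp
        (((ContinuousLinearMap.apply ℂ H M.ψ).continuous.tendsto P).comp hP)
    refine tendsto_nhds_unique h1 (tendsto_const_nhds.congr' ?_)
    filter_upwards [hiso] with z hz
    have h2 := inner_symm_of_adjoint M.isExtension.2 (relResolvent_mem hz M.ψ) hη
    simp only [inner_smul_left, inner_add_right, inner_smul_right, hlc] at h2
    rw [inner_smul_right, sub_mul, h2]
    ring
  have hne : M.xi l ≠ 0 := by
    rw [hxi]
    refine smul_ne_zero (M.h_simple l ((M.h_zero_iff l).2 hl)) (smul_ne_zero hlv fun h0 => ?_)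
    rw [h0, inner_zero_right] at hPη
    refine hψη ?_
    rw [← inner_conj_symm, neg_eq_zero.1 hPη.symm, map_zero]
  have hxiB : (M.xi l, l • M.xi l) ∈ M.Aγ := by
    have := M.Aγ.smul_mem (deriv M.h l * (l - M.v)) (residue_mem M.isExtension.2 hiso hP M.ψ)
    rwa [Prod.smul_mk, smul_comm _ l, mul_smul, ← hxi] at this
  refine ⟨hne, le_antisymm (fun θ hθ => ?_) ?_⟩
  -- `Aγ` is spanned by `A` and `(ξ(l), lξ(l))`; `(θ, lθ)` pairs symmetrically with both, so it lies
  -- in `Aγ* = Aγ`.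
  · have hθB : (θ, l • θ) ∈ M.Aγ := by
      rw [← M.isExtension.2, mem_adjoint_iff']
      rintro ⟨x, y⟩ hxy
      obtain ⟨t, ht⟩ := M.exists_mem_graph_add_smul hA hl hne hxiB hxy
      have h1 := mem_kerShift_adjointRel.1 hθ _ ht
      simp only [inner_sub_left, inner_smul_left, inner_smul_right, hlc] at h1 ⊢
      linear_combination h1
    -- Modulo `ξ(l)`, `θ` is an eigenvector of `A`, hence zero by regularity.
    obtain ⟨t, ht⟩ := M.exists_mem_graph_add_smul hA hl hne hxiB hθB
    rw [smul_comm t l, ← smul_sub] at ht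
    exact Submodule.mem_span_singleton.2 ⟨t, (sub_eq_zero.1 (hA.eq_zero_of_mem_graph ht)).symm⟩
  · rw [Submodule.span_singleton_le_iff_mem]
    exact mem_adjointRel_of_isExtension M.isExtension hxiB

/-- `ker(A* - zI)` is spanned by the nonzero vector `ξ(z)`. -/
theorem kerShift_eq_span_xi (hA : InClassS A) (z : ℂ) :
    M.xi z ≠ 0 ∧ kerShift (adjointRel A) z = Submodule.span ℂ {M.xi z} := by
  by_cases hz : z ∈ relSpectrum M.Aγ
  · exact M.kerShift_of_mem hA hz
  · exact M.kerShift_of_notMem hA hz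

theorem mem_ranShift_iff (hA : InClassS A) {z : ℂ} {f : H} :
    f ∈ ranShift A z ↔ M.Phi f z = 0 := by
  rw [hA.mem_ranShift_iff, (M.kerShift_eq_span_xi hA (conj z)).2]
  constructor
  · exact fun h => h _ (Submodule.mem_span_singleton_self _)
  · intro h θ hθ
    obtain ⟨c, rfl⟩ := Submodule.mem_span_singleton.1 hθ
    rw [inner_smul_left]
    exact mul_eq_zero_of_right _ h

/-- A vector `g` spans a complement of `ran(A - zI)` if and only if `(Φg)(z) ≠ 0`. -/
theorem isCompl_ranShift_iff (hA : InClassS A) {z : ℂ} {g : H} :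
    IsCompl (ranShift A z) (Submodule.span ℂ {g}) ↔ M.Phi g z ≠ 0 := by
  constructor
  · intro hc h0
    have hg : g ∈ ranShift A z := (M.mem_ranShift_iff hA).2 h0
    have htop : ranShift A z = ⊤ := by
      rw [← hc.sup_eq_top, eq_comm, sup_eq_left, Submodule.span_singleton_le_iff_mem]
      exact hg
    -- If the range were everything, `ξ(z̄)` would be orthogonal to itself.
    have hx : M.xi (conj z) ∈ ranShift A z := htop ▸ Submodule.mem_top
    exact (M.kerShift_eq_span_xi hA (conj z)).1
      (inner_self_eq_zero.1 ((M.mem_ranShift_iff hA).1 hx))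
  · intro h0
    refine ⟨Submodule.disjoint_def.2 fun x hx hxg => ?_, codisjoint_iff.2 ?_⟩
    · obtain ⟨c, rfl⟩ := Submodule.mem_span_singleton.1 hxg
      have h1 := (M.mem_ranShift_iff hA).1 hx
      rw [map_smul, Pi.smul_apply, smul_eq_mul, mul_eq_zero] at h1
      rw [h1.resolve_right h0, zero_smul]
    · refine eq_top_iff.2 fun f _ => ?_
      refine Submodule.mem_sup.2 ⟨f - (M.Phi f z / M.Phi g z) • g, (M.mem_ranShift_iff hA).2 ?_,
        (M.Phi f z / M.Phi g z) • g, Submodule.mem_span_singleton.2 ⟨_, rfl⟩, sub_add_cancel _ _⟩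
      rw [map_sub, map_smul, Pi.sub_apply, Pi.smul_apply, smul_eq_mul, div_mul_cancel₀ _ h0,
        sub_self]

omit [CompleteSpace H] in
theorem Phi_sum_pow_smul (n : ℕ) (μ : Fin (n + 1) → H) (z : ℂ) :
    M.Phi (∑ k : Fin (n + 1), z ^ (k : ℕ) • μ k) z
      = ∑ k : Fin (n + 1), z ^ (k : ℕ) * M.Phi (μ k) z := by
  simp only [map_sum, map_smul, Finset.sum_apply, Pi.smul_apply, smul_eq_mul]

end ModelData

end

end NEntire

/-! ### The equivalence. -/

theorem mainTheorem3 {H : Type*} [NormedAddCommGroup H] [InnerProductSpace ℂ H] [CompleteSpace H]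
    (A : H →ₗ.[ℂ] H) (hA : NEntire.InClassS A) (M : NEntire.ModelData A) (n : ℕ) :
    NEntire.IsNEntire n A ↔
      ∃ m ∈ NEntire.assocFunctions n M.space, Differentiable ℂ m ∧ ∀ z : ℂ, m z ≠ 0 := by
  constructor
  · rintro ⟨-, μ, hμ⟩
    refine ⟨fun z => ∑ k : Fin (n + 1), z ^ (k : ℕ) * M.Phi (μ k) z,
      ⟨fun k => M.Phi (μ k), fun k => ⟨μ k, rfl⟩, fun z => rfl⟩, ?_, fun z => ?_⟩
    · exact Differentiable.fun_sum fun k _ =>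
        (differentiable_id.pow _).mul (M.differentiable_Phi (μ k))
    · dsimp only
      rw [← M.Phi_sum_pow_smul n μ z]
      exact (M.isCompl_ranShift_iff hA).1 (hμ z)
  · rintro ⟨m, ⟨f, hf, hm⟩, -, hm0⟩
    -- The `Φ`-preimages of the coefficient functions serve as the vectors `μₖ`.
    choose μ hμ using hf
    refine ⟨hA, μ, fun z => (M.isCompl_ranShift_iff hA).2 ?_⟩
    rw [M.Phi_sum_pow_smul n μ z]
    simp only [hμ]
    rw [← hm z]
    exact hm0 z
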